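/- Let $\lambda=(\lambda_1\ge\lambda_2\ge\cdots\ge 0)$ be a partition (possibly empty; $\lambda_i=0$ for all but finitely many $i$), let $|\lambda|=\sum_i\lambda_i$, let $m$ be its length (the number of nonzero parts), let $\mu$ be the conjugate partition, $\mu_i=\#\{j:\lambda_j\ge i\}$, and let $n=\lambda_1$, which is the length of $\mu$. For an integer $k\ge 0$ put $$D_\lambda(k)=\det\left(\binom{2k-i-\lambda_{k-i+1}}{2k-2j}\right)_{1\le i,j\le k}.$$ For a formal power series $f$, let $[y_1^{u_1}\cdots y_m^{u_m}]\,f$ denote the coefficient of the monomial $y_1^{u_1}\cdots y_m^{u_m}$ in $f$. Then for every integer $k\ge\max(m,\lambda_1)$, $$D_\lambda(k)=2^{\binom k2-|\lambda|}\,[y_1^{\lambda_1+m-1}y_2^{\lambda_2+m-2}\cdots y_m^{\lambda_m}]\left(\prod_{1\le i<j\le m}(y_i-y_j)(1-y_i-y_j)\prod_{l=1}^m(1-y_l)^{-k-m}\right),$$ and also $$D_\lambda(k)=2^{\binom k2-|\lambda|}\,[z_1^{\mu_1+n-1}z_2^{\mu_2+n-2}\cdots z_n^{\mu_n}]\left(\prod_{1\le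 i<j\le n}(z_i-z_j)(1+z_i+z_j)\prod_{l=1}^n(1+2z_l)(1+z_l)^{k-n}\right).$$ Empty products and the $0\times 0$ determinant are $1$. -/

import Mathlib

open scoped BigOperators

/-!
Partitions are represented by their (English) Young diagrams, with rows and columns numbered
from `0`: the `i`-th part `λ_i` (`i ≥ 1`) is `lam.rowLen (i - 1)`, which is `0` beyond the length,
the weight `|λ|` is `lam.card`, and the conjugate partition is `lam.transpose`.
Likewise an index `i : Fin N` stands for the mathematical index `i + 1 ∈ {1, …, N}`.
-/

namespace BinomDet

/-- The length `l(λ)`: the number of non-zero parts of the partition. -/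
def length (lam : YoungDiagram) : ℕ := lam.rowLens.length

/-- The determinant `D_λ(k) = det (binom (2k - i - λ_{k-i+1}) (2k - 2j))_{1 ≤ i, j ≤ k}`.
The upper entries are integers; `Ring.choose a b = a (a - 1) ⋯ (a - b + 1) / b!`. -/
noncomputable def D (lam : YoungDiagram) (k : ℕ) : ℤ :=
  Matrix.det (Matrix.of fun i j : Fin k =>
    Ring.choose (2 * (k : ℤ) - (((i : ℕ) : ℤ) + 1) - (lam.rowLen (k - ((i : ℕ) + 1)) : ℤ))
      (2 * k - 2 * ((j : ℕ) + 1)))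

/-- The exponent vector `ν + δ_N = (ν_1 + N - 1, ν_2 + N - 2, …, ν_N)`. -/
noncomputable def expo (nu : YoungDiagram) (N : ℕ) : Fin N →₀ ℕ :=
  Finsupp.equivFunOnFinite.symm fun l => nu.rowLen (l : ℕ) + (N - ((l : ℕ) + 1))

/-- The formal power series
`∏_{i<j} (y_i - y_j) (1 - y_i - y_j) ∏_l (1 - y_l)^{-k-m}` in `y_1, …, y_m`. -/
noncomputable def ySeries (m k : ℕ) : MvPowerSeries (Fin m) ℚ :=
  (∏ i : Fin m, ∏ j ∈ Finset.Ioi i,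
    (MvPowerSeries.X i - MvPowerSeries.X j) * (1 - MvPowerSeries.X i - MvPowerSeries.X j)) *
  ∏ l : Fin m, ((1 - MvPowerSeries.X l)⁻¹) ^ (k + m)

/-- The polynomial
`∏_{i<j} (z_i - z_j) (1 + z_i + z_j) ∏_l (1 + 2 z_l) (1 + z_l)^{k-n}` in `z_1, …, z_n`
(used for `n ≤ k`). -/
noncomputable def zPoly (n k : ℕ) : MvPolynomial (Fin n) ℚ :=
  (∏ i : Fin n, ∏ j ∈ Finset.Ioi i,
    (MvPolynomial.X i - MvPolynomial.X j) * (1 + MvPolynomial.X i + MvPolynomial.X j)) *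
  ∏ l : Fin n, (1 + 2 * MvPolynomial.X l) * (1 + MvPolynomial.X l) ^ (k - n)

end BinomDet

/-! Reversing rows and columns turns `D lam k` into the determinant of binom(a_i, 2c) with a_i = k +
i - λ_{i+1} and 0 ≤ i, c < k. Only even lower indices occur, so the plan is to find generating
functions whose binomial expansions have no odd, respectively no even, part.

Both products are Vandermonde products, in w = y(1-y) and w = z(1+z), so their coefficients are
determinants of one-variable coefficients. Vanishing parts do not affect these determinants, so both
may be taken of size k.

For y, expand (2y)^a in powers of 2y-1. The odd powers contribute nothing to the required
coefficients (`coeff_odd_pow_mul_eq_zero`), so the y-matrix is, up to powers of 2, the binomial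
matrix times a matrix independent of λ.

For z, the polynomials (1+2z)(z(1+z))^s are odd about z = -1/2, so their coefficient vectors,
rescaled, are orthogonal to the even columns of the 2k × 2k Pascal matrix. The exponents used for μ
are the complement of the a_i in {0, …, 2k-1}, and Jacobi's argument for complementary minors
relates the two determinants, with sign (-1)^|λ| (`IsConjugate.det_zMatrix_mul_det_pascal`).

The z-constant is read off at the staircase partition, where everything is triangular; the empty
partition then gives the y-constant. -/

namespace BinomDet

/-! ### Coefficients of Vandermonde products as determinants -/

/-- The embedding of `ℚ⟦X⟧` into the power series in several variables sending `X` to `X i`. -/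
noncomputable def varHom {N : ℕ} (i : Fin N) : PowerSeries ℚ →ₐ[ℚ] MvPowerSeries (Fin N) ℚ :=
  PowerSeries.substAlgHom (PowerSeries.HasSubst.X (S := ℚ) i)

theorem varHom_X {N : ℕ} (i : Fin N) : varHom i PowerSeries.X = MvPowerSeries.X i :=
  PowerSeries.substAlgHom_X _

theorem coeff_varHom {N : ℕ} (i : Fin N) (f : PowerSeries ℚ) (e : Fin N →₀ ℕ) :
    MvPowerSeries.coeff e (varHom i f) =
      if e = Finsupp.single i (e i) then PowerSeries.coeff (e i) f else 0 := by
  classical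
  rw [varHom, PowerSeries.coe_substAlgHom, PowerSeries.coeff_subst_single]

theorem coeff_prod_varHom {N : ℕ} (f : Fin N → PowerSeries ℚ) (e : Fin N →₀ ℕ) :
    MvPowerSeries.coeff e (∏ i, varHom i (f i)) = ∏ i, PowerSeries.coeff (e i) (f i) := by
  classical
  rw [MvPowerSeries.coeff_prod]
  let l₀ : Fin N →₀ (Fin N →₀ ℕ) :=
    Finsupp.equivFunOnFinite.symm fun i => Finsupp.single i (e i)
  have hsum : ∀ i : Fin N, ∑ j, (Finsupp.single j (e j) : Fin N →₀ ℕ) i = e i := by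
    intro i
    rw [Finset.sum_eq_single i] <;> simp +contextual
  rw [Finset.sum_eq_single l₀]
  · refine Finset.prod_congr rfl fun i _ => ?_
    simp [coeff_varHom, l₀]
  · intro l hl hne
    rw [Finset.mem_finsuppAntidiag] at hl
    by_contra hprod
    refine hne ?_
    have hs : ∀ i, l i = Finsupp.single i (l i i) := by
      intro i
      by_contra hcon
      refine hprod (Finset.prod_eq_zero (Finset.mem_univ i) ?_)
      rw [coeff_varHom, if_neg hcon]
    have he : ∀ i, l i i = e i := by
      intro i
      rw [← hl.1, Finsupp.finsetSum_apply, Finset.sum_eq_single i]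
      · intro j _ hji
        rw [hs j, Finsupp.single_apply, if_neg hji]
      · simp
    ext1 i
    rw [hs i, he i]
    simp [l₀]
  · intro h
    refine absurd ?_ h
    rw [Finset.mem_finsuppAntidiag]
    refine ⟨?_, by simp⟩
    ext i
    rw [Finsupp.finsetSum_apply]
    exact hsum i

theorem coeff_det_varHom {N : ℕ} (f : Fin N → Fin N → PowerSeries ℚ) (e : Fin N →₀ ℕ) :
    MvPowerSeries.coeff e (Matrix.det (Matrix.of fun i j => varHom i (f i j))) =
      Matrix.det (Matrix.of fun i j => PowerSeries.coeff (e i) (f i j)) := by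
  rw [← Matrix.det_transpose, ← Matrix.det_transpose (Matrix.of fun i j => _), Matrix.det_apply',
    Matrix.det_apply', map_sum]
  refine Finset.sum_congr rfl fun σ _ => ?_
  have : ((Equiv.Perm.sign σ : ℤ) : MvPowerSeries (Fin N) ℚ) =
      MvPowerSeries.C ((Equiv.Perm.sign σ : ℤ) : ℚ) := by simp
  rw [this, MvPowerSeries.coeff_C_mul]
  congr 1
  exact coeff_prod_varHom _ e

/-- Each row of the Vandermonde matrix involves a single variable, so extracting a monomial acts row
by row. -/
theorem coeff_vandermonde_mul_prod {N : ℕ} (w g : PowerSeries ℚ) (e : Fin N →₀ ℕ) :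
    MvPowerSeries.coeff e ((∏ i : Fin N, ∏ j ∈ Finset.Ioi i, (varHom i w - varHom j w)) *
        ∏ l, varHom l g) =
      Matrix.det (Matrix.of fun i j : Fin N =>
        PowerSeries.coeff (e i) (w ^ (N - ((j : ℕ) + 1)) * g)) := by
  rw [← coeff_det_varHom]
  have h := Matrix.det_projVandermonde (1 : Fin N → MvPowerSeries (Fin N) ℚ) (fun i => varHom i w)
  simp only [Pi.one_apply, one_mul] at h
  rw [← h, mul_comm, ← Matrix.det_mul_column]
  congr 2
  ext1 i j
  simp [Matrix.projVandermonde_apply, Fin.val_rev, mul_comm]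

/-- Laplace expansion along the last row removes one index at a time. This is what discards the
vanishing parts of a partition. -/
theorem det_eq_det_of_triangular_tail (E : ℕ → ℕ → ℚ) (m : ℕ)
    (h0 : ∀ i j, m ≤ i → j < i → E i j = 0) (h1 : ∀ i, m ≤ i → E i i = 1) {k : ℕ} (hk : m ≤ k) :
    Matrix.det (Matrix.of fun i j : Fin k => E i j) =
      Matrix.det (Matrix.of fun i j : Fin m => E i j) := by
  induction k, hk using Nat.le_induction with
  | base => rfl
  | succ k hk ih =>
    rw [Matrix.det_succ_row _ (Fin.last k), Fin.sum_univ_castSucc, Finset.sum_eq_zero, zero_add,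
      ← ih]
    · simp only [Matrix.of_apply, Fin.val_last, h1 k hk, mul_one, ← two_mul, pow_mul]
      norm_num
      rfl
    · intro j _
      simp [h0 k j hk j.2]

end BinomDet

/-! ### One-variable entries of the two generating functions -/

namespace BinomDet

open PowerSeries

theorem constantCoeff_one_sub_X : constantCoeff (1 - X : PowerSeries ℚ) ≠ 0 := by simp

theorem one_sub_X_mul_inv : (1 - X : PowerSeries ℚ) * (1 - X)⁻¹ = 1 :=
  PowerSeries.mul_inv_cancel _ constantCoeff_one_sub_X

theorem one_sub_X_pow_mul_inv_pow (a b : ℕ) :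
    (1 - X : PowerSeries ℚ) ^ a * ((1 - X)⁻¹) ^ (a + b) = ((1 - X)⁻¹) ^ b := by
  rw [pow_add, ← mul_assoc, ← mul_pow, one_sub_X_mul_inv, one_pow, one_mul]

theorem coeff_inv_one_sub_X_pow (d n : ℕ) :
    coeff n (((1 - X : PowerSeries ℚ)⁻¹) ^ (d + 1)) = ((d + n).choose d : ℚ) := by
  have h : ((1 - X : PowerSeries ℚ)⁻¹) ^ (d + 1) = (invOneSubPow ℚ (d + 1)).val := by
    have h1 := (invOneSubPow ℚ (d + 1)).inv_val
    have h2 := one_sub_X_pow_mul_inv_pow (d + 1) 0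
    rw [invOneSubPow_inv_eq_one_sub_pow] at h1
    calc _ = ((1 - X : PowerSeries ℚ)⁻¹) ^ (d + 1) *
          ((1 - X) ^ (d + 1) * (invOneSubPow ℚ (d + 1)).val) := by rw [h1, mul_one]
      _ = ((1 - X) ^ (d + 1) * ((1 - X : PowerSeries ℚ)⁻¹) ^ (d + 1)) *
          (invOneSubPow ℚ (d + 1)).val := by ring
      _ = _ := by
        rw [add_zero, pow_zero] at h2
        rw [h2, one_mul]
  rw [h, invOneSubPow_val_succ_eq_mk_add_choose, coeff_mk]

/-- The powers of 1-X cancel so that N disappears: for fixed k, the matrices for all N are corners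
of one infinite matrix. -/
theorem coeff_ySeries_entry (k l i j N : ℕ) (hi : i < N) (hj : j < N) :
    coeff (l + (N - (i + 1)))
        ((X * (1 - X) : PowerSeries ℚ) ^ (N - (j + 1)) * ((1 - X)⁻¹) ^ (k + N)) =
      if i ≤ l + j then coeff (l + j - i) (((1 - X : PowerSeries ℚ)⁻¹) ^ (k + j + 1)) else 0 := by
  have h : k + N = N - (j + 1) + (k + j + 1) := by omega
  rw [h, mul_pow, mul_assoc, one_sub_X_pow_mul_inv_pow, coeff_X_pow_mul']
  split_ifs with h1 h2 h2
  · congr 2; omega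
  · omega
  · omega
  · rfl

theorem coeff_zSeries_entry (k l i j N : ℕ) (hi : i < N) (hj : j < N) (hN : N ≤ k) :
    coeff (l + (N - (i + 1)))
        ((X * (1 + X) : PowerSeries ℚ) ^ (N - (j + 1)) * ((1 + 2 * X) * (1 + X) ^ (k - N))) =
      if i ≤ l + j then
        coeff (l + j - i) ((1 + 2 * X : PowerSeries ℚ) * (1 + X) ^ (k - (j + 1))) else 0 := by
  have h : k - (j + 1) = N - (j + 1) + (k - N) := by omega
  rw [h, pow_add, mul_pow, mul_assoc, coeff_X_pow_mul', mul_left_comm]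
  split_ifs with h1 h2 h2
  · congr 2; omega
  · omega
  · omega
  · rfl

theorem varHom_inv_one_sub_X {N : ℕ} (i : Fin N) :
    varHom i ((1 - X)⁻¹) = (1 - MvPowerSeries.X i)⁻¹ := by
  rw [eq_comm, MvPowerSeries.inv_eq_iff_mul_eq_one (by simp), ← varHom_X, ← map_one (varHom i),
    ← map_sub, ← map_mul, mul_comm, one_sub_X_mul_inv]

theorem coeff_ySeries (k N : ℕ) (e : Fin N →₀ ℕ) :
    MvPowerSeries.coeff e (ySeries N k) = Matrix.det (Matrix.of fun i j : Fin N =>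
      coeff (e i) ((X * (1 - X) : PowerSeries ℚ) ^ (N - ((j : ℕ) + 1)) *
        ((1 - X)⁻¹) ^ (k + N))) := by
  rw [← coeff_vandermonde_mul_prod, ySeries]
  congr 2
  · refine Finset.prod_congr rfl fun i _ => Finset.prod_congr rfl fun j _ => ?_
    simp only [map_mul, map_sub, map_one, varHom_X]
    ring
  · refine Finset.prod_congr rfl fun i _ => ?_
    rw [map_pow, varHom_inv_one_sub_X]

theorem coeff_zPoly (k N : ℕ) (e : Fin N →₀ ℕ) :
    MvPolynomial.coeff e (zPoly N k) = Matrix.det (Matrix.of fun i j : Fin N =>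
      coeff (e i) ((X * (1 + X) : PowerSeries ℚ) ^ (N - ((j : ℕ) + 1)) *
        ((1 + 2 * X) * (1 + X) ^ (k - N)))) := by
  rw [← coeff_vandermonde_mul_prod, ← MvPolynomial.coeff_coe, zPoly,
    ← MvPolynomial.coeToMvPowerSeries.ringHom_apply, map_mul]
  simp only [map_prod, map_mul, map_sub, map_add, map_one, map_pow, map_ofNat, varHom_X,
    MvPolynomial.coeToMvPowerSeries.ringHom_apply, MvPolynomial.coe_X]
  congr 2
  refine Finset.prod_congr rfl fun i _ => Finset.prod_congr rfl fun j _ => ?_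
  ring

end BinomDet

/-! ### The y-formula up to a constant -/

namespace BinomDet

open PowerSeries

theorem coeff_two_mul_X_sub_one_mul_inv_pow (t : ℕ) :
    coeff (t + 1) ((2 * X - 1 : PowerSeries ℚ) * ((1 - X)⁻¹) ^ (t + 2)) = 0 := by
  have h1 : (2 * X - 1 : PowerSeries ℚ) * ((1 - X)⁻¹) ^ (t + 2) =
      X * (C 2 * ((1 - X)⁻¹) ^ (t + 2)) - ((1 - X)⁻¹) ^ (t + 2) := by
    rw [map_ofNat]; ring
  rw [h1, map_sub, coeff_succ_X_mul, coeff_C_mul, coeff_inv_one_sub_X_pow,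
    coeff_inv_one_sub_X_pow]
  have h2 : (t + 1 + (t + 1)).choose (t + 1) = 2 * (t + 1 + t).choose (t + 1) := by
    have : t + 1 + (t + 1) = (2 * t + 1) + 1 := by ring
    rw [this, Nat.choose_succ_succ, Nat.succ_eq_add_one, ← Nat.choose_symm_half t,
      show t + 1 + t = 2 * t + 1 by ring]
    omega
  rw [h2]
  push_cast
  ring

/-- Since (2X-1)^2 = 1 - 4X(1-X), two factors 2X-1 can be traded for a shift of s. What remains is c
= 0, which is the identity binom(2t+2, t+1) = 2 binom(2t+1, t+1). -/
theorem coeff_odd_pow_mul_eq_zero (N c : ℕ) : ∀ s : ℕ, s + c + 2 ≤ N →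
    coeff (N - 1) ((2 * X - 1 : PowerSeries ℚ) ^ (2 * c + 1) *
      ((X * (1 - X)) ^ s * ((1 - X)⁻¹) ^ N)) = 0 := by
  induction c with
  | zero =>
    intro s hs
    obtain ⟨t, rfl⟩ : ∃ t, N = s + (t + 2) := ⟨N - s - 2, by omega⟩
    rw [mul_pow, mul_assoc, one_sub_X_pow_mul_inv_pow, mul_left_comm, coeff_X_pow_mul',
      if_pos (by omega), show s + (t + 2) - 1 - s = t + 1 by omega, mul_zero, zero_add, pow_one]
    exact coeff_two_mul_X_sub_one_mul_inv_pow t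
  | succ c ih =>
    intro s hs
    have h : (2 * X - 1 : PowerSeries ℚ) ^ (2 * (c + 1) + 1) *
        ((X * (1 - X)) ^ s * ((1 - X)⁻¹) ^ N) =
        (2 * X - 1) ^ (2 * c + 1) * ((X * (1 - X)) ^ s * ((1 - X)⁻¹) ^ N) -
        C 4 * ((2 * X - 1) ^ (2 * c + 1) * ((X * (1 - X)) ^ (s + 1) * ((1 - X)⁻¹) ^ N)) := by
      rw [map_ofNat]; ring
    rw [h, map_sub, coeff_C_mul, ih s (by omega), ih (s + 1) (by omega)]
    simp

theorem sum_range_two_mul {M : Type*} [AddCommMonoid M] (f : ℕ → M) (k : ℕ) :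
    ∑ d ∈ Finset.range (2 * k), f d = ∑ c ∈ Finset.range k, (f (2 * c) + f (2 * c + 1)) := by
  induction k with
  | zero => simp
  | succ k ih =>
    rw [Finset.sum_range_succ, ← ih, Nat.mul_succ, Finset.sum_range_succ, Finset.sum_range_succ,
      add_assoc]

theorem sum_choose_mul_coeff (k s a : ℕ) (hs : s < k) (ha : a < 2 * k) :
    (2 : ℚ) ^ a * coeff (2 * k - 1 - a)
        ((X * (1 - X) : PowerSeries ℚ) ^ s * ((1 - X)⁻¹) ^ (2 * k)) =
      ∑ c : Fin k, (a.choose (2 * (c : ℕ)) : ℚ) *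
        coeff (2 * k - 1) ((2 * X - 1 : PowerSeries ℚ) ^ (2 * (c : ℕ)) *
          ((X * (1 - X)) ^ s * ((1 - X)⁻¹) ^ (2 * k))) := by
  set W : PowerSeries ℚ := (X * (1 - X)) ^ s * ((1 - X)⁻¹) ^ (2 * k) with hW
  have h1 : (2 : ℚ) ^ a * coeff (2 * k - 1 - a) W = coeff (2 * k - 1) ((2 * X) ^ a * W) := by
    rw [show (2 * X : PowerSeries ℚ) ^ a * W = C (2 ^ a) * (X ^ a * W) by
      rw [map_pow, map_ofNat]; ring, coeff_C_mul, coeff_X_pow_mul', if_pos (by omega)]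
  have h2 : (2 * X : PowerSeries ℚ) ^ a =
      ∑ d ∈ Finset.range (2 * k), C (a.choose d : ℚ) * (2 * X - 1) ^ d := by
    rw [show (2 * X : PowerSeries ℚ) ^ a = ((2 * X - 1) + 1) ^ a by rw [sub_add_cancel], add_pow]
    simp only [one_pow, mul_one, map_natCast]
    simp only [mul_comm ((2 * X - 1 : PowerSeries ℚ) ^ _)]
    have hsub : Finset.range (a + 1) ⊆ Finset.range (2 * k) := Finset.range_mono (by omega)
    rw [← Finset.sum_subset hsub]
    intro x _ hx
    · rw [Nat.choose_eq_zero_of_lt (by simpa [Nat.succ_le_iff] using hx)]; simp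
  rw [h1, h2, Finset.sum_mul, map_sum, sum_range_two_mul, Fin.sum_univ_eq_sum_range
    (fun c => (a.choose (2 * c) : ℚ) *
        coeff (2 * k - 1) ((2 * X - 1 : PowerSeries ℚ) ^ (2 * c) * W))]
  refine Finset.sum_congr rfl fun c hc => ?_
  rw [Finset.mem_range] at hc
  rw [mul_assoc, mul_assoc, coeff_C_mul, coeff_C_mul, hW,
    coeff_odd_pow_mul_eq_zero (2 * k) c s (by omega), mul_zero, add_zero]

/-- The matrix `binom (k + i - l_i, 2 c)`. -/
def binomMatrix (k : ℕ) (l : Fin k → ℕ) : Matrix (Fin k) (Fin k) ℚ :=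
  Matrix.of fun i c => ((k + (i : ℕ) - l i).choose (2 * (c : ℕ)) : ℚ)

/-- The matrix of coefficients whose determinant is that of the `y`-series in `k` variables. -/
noncomputable def yMatrix (k : ℕ) (l : Fin k → ℕ) : Matrix (Fin k) (Fin k) ℚ :=
  Matrix.of fun i j => coeff (l i + (k - ((i : ℕ) + 1)))
    ((X * (1 - X) : PowerSeries ℚ) ^ (k - ((j : ℕ) + 1)) * ((1 - X)⁻¹) ^ (k + k))

theorem exists_mul_det_yMatrix (k : ℕ) : ∃ τ : ℚ, ∀ l : Fin k → ℕ, (∀ i, l i ≤ k) →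
    2 ^ (∑ i : Fin k, (k + (i : ℕ) - l i)) * (yMatrix k l).det = (binomMatrix k l).det * τ := by
  -- The right-hand factor in `sum_choose_mul_coeff` involves neither l nor the row index; row i is
  -- scaled with a = k + i - l i, so that 2k - 1 - a is the exponent in `yMatrix`.
  refine ⟨Matrix.det (Matrix.of fun c j : Fin k =>
    coeff (2 * k - 1) ((2 * X - 1 : PowerSeries ℚ) ^ (2 * (c : ℕ)) *
          ((X * (1 - X)) ^ (k - ((j : ℕ) + 1)) * ((1 - X)⁻¹) ^ (2 * k)))), fun l hl => ?_⟩
  rw [← Matrix.det_mul, ← Finset.prod_pow_eq_pow_sum, ← Matrix.det_mul_column]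
  congr 1
  ext i j
  rw [Matrix.mul_apply]
  simp only [binomMatrix, yMatrix, Matrix.of_apply]
  have := hl i
  rw [← sum_choose_mul_coeff k _ _ (by omega) (by omega), ← two_mul]
  congr 2
  congr 1
  omega

theorem det_yMatrix_eq (k m : ℕ) (l : ℕ → ℕ) (hm : ∀ i, m ≤ i → l i = 0) (hk : m ≤ k) :
    (yMatrix k fun i => l i).det = Matrix.det (Matrix.of fun i j : Fin m =>
      coeff (l i + (m - ((i : ℕ) + 1))) ((X * (1 - X) : PowerSeries ℚ) ^ (m - ((j : ℕ) + 1)) *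
        ((1 - X)⁻¹) ^ (k + m))) := by
  have key : ∀ N : ℕ, (Matrix.of fun i j : Fin N =>
      coeff (l i + (N - ((i : ℕ) + 1))) ((X * (1 - X) : PowerSeries ℚ) ^ (N - ((j : ℕ) + 1)) *
        ((1 - X)⁻¹) ^ (k + N))) = Matrix.of fun i j : Fin N =>
      (fun i j : ℕ => if i ≤ l i + j then
        coeff (l i + j - i) (((1 - X : PowerSeries ℚ)⁻¹) ^ (k + j + 1)) else 0) i j := by
    intro N
    ext i j
    exact coeff_ySeries_entry k (l i) i j N i.2 j.2
  rw [yMatrix, key, key]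
  refine det_eq_det_of_triangular_tail (fun i j : ℕ => if i ≤ l i + j then
    coeff (l i + j - i) (((1 - X : PowerSeries ℚ)⁻¹) ^ (k + j + 1)) else 0) m (fun i j hi hj => ?_) (fun i hi => ?_) hk
  · simp [hm i hi, hj]
  · simp [hm i hi, coeff_zero_eq_constantCoeff]

theorem two_pow_mul_det_binomMatrix_eq_det_zero (k : ℕ) (l : Fin k → ℕ) (hl : ∀ i, l i ≤ k) :
    2 ^ (∑ i, l i) * (binomMatrix k l).det =
      (binomMatrix k fun _ => 0).det * (yMatrix k l).det := by
  obtain ⟨τ, hτ⟩ := exists_mul_det_yMatrix k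
  have h1 := hτ l hl
  have h2 := hτ (fun _ => 0) fun _ => Nat.zero_le _
  -- With no nonzero part the determinant shrinks to size 0.
  have h3 : (yMatrix k fun _ => 0).det = 1 := by
    rw [det_yMatrix_eq k 0 (fun _ => 0) (fun _ _ => rfl) (Nat.zero_le k)]
    simp
  have h4 : ∑ i : Fin k, (k + (i : ℕ) - 0) = ∑ i, l i + ∑ i : Fin k, (k + (i : ℕ) - l i) := by
    rw [← Finset.sum_add_distrib]
    refine Finset.sum_congr rfl fun i _ => ?_
    have := hl i
    omega
  rw [h3, mul_one, h4, pow_add] at h2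
  have hτ0 : τ ≠ 0 := by
    rintro rfl
    simp at h2
  apply mul_right_cancel₀ hτ0
  rw [mul_assoc, ← h1, ← mul_assoc, h2]
  ring

end BinomDet

/-! ### Conjugate partitions as complementary sets of positions -/

namespace BinomDet

open Polynomial

/-- `l` and `u` are the row and column lengths of a partition contained in a `k × k` square. -/
structure IsConjugate {k : ℕ} (l u : Fin k → ℕ) : Prop where
  row_le : ∀ i, l i ≤ k
  col_le : ∀ j, u j ≤ k
  lt_iff : ∀ i j : Fin k, (j : ℕ) < l i ↔ (i : ℕ) < u j

namespace IsConjugate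

variable {k : ℕ} {l u : Fin k → ℕ}

theorem symm (h : IsConjugate l u) : IsConjugate u l :=
  ⟨h.col_le, h.row_le, fun i j => (h.lt_iff j i).symm⟩

theorem antitone (h : IsConjugate l u) : Antitone l := by
  intro i i' hi
  by_contra! hcon
  have hk : l i < k := hcon.trans_le (h.row_le i')
  have h1 := (h.lt_iff i' ⟨l i, hk⟩).1 hcon
  have h2 := (h.lt_iff i ⟨l i, hk⟩).2 (lt_of_le_of_lt hi h1)
  exact lt_irrefl _ h2

theorem card_filter (h : IsConjugate l u) (i : Fin k) :
    (Finset.univ.filter fun j : Fin k => (j : ℕ) < l i).card = l i := by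
  rw [Fin.card_filter_val_lt]
  exact min_eq_right (h.row_le i)

theorem sum_eq (h : IsConjugate l u) : ∑ i, l i = ∑ j, u j := by
  have h1 : ∀ i, l i = ∑ j : Fin k, if (j : ℕ) < l i then 1 else 0 := fun i => by
    rw [← Finset.card_filter, h.card_filter]
  have h2 : ∀ j, u j = ∑ i : Fin k, if (j : ℕ) < l i then 1 else 0 := fun j => by
    simp only [h.lt_iff]
    rw [← Finset.card_filter, h.symm.card_filter]
  rw [Finset.sum_congr rfl fun i _ => h1 i, Finset.sum_comm, Finset.sum_congr rfl fun j _ => h2 j]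

/-- The positions `k + i - l i` and `k - 1 - j + u j`, which together exhaust `{0, …, 2 k - 1}`. -/
def pos (h : IsConjugate l u) : Fin k ⊕ Fin k → Fin (2 * k) :=
  Sum.elim (fun i => ⟨k + i - l i, by omega⟩)
    (fun j => ⟨k - (j + 1) + u j, by have := h.col_le j; omega⟩)

theorem pos_inl_lt_iff (h : IsConjugate l u) (i i' : Fin k) :
    h.pos (Sum.inl i) < h.pos (Sum.inl i') ↔ i < i' := by
  have h1 := h.row_le i
  have h2 := h.row_le i'
  have h3 : i ≤ i' → l i' ≤ l i := fun e => h.antitone e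
  have h4 : i' ≤ i → l i ≤ l i' := fun e => h.antitone e
  simp only [pos, Sum.elim_inl, Fin.lt_def, Fin.le_def] at *
  omega

theorem pos_inr_lt_iff (h : IsConjugate l u) (j j' : Fin k) :
    h.pos (Sum.inr j) < h.pos (Sum.inr j') ↔ j' < j := by
  have h3 : j ≤ j' → u j' ≤ u j := fun e => h.symm.antitone e
  have h4 : j' ≤ j → u j ≤ u j' := fun e => h.symm.antitone e
  simp only [pos, Sum.elim_inr, Fin.lt_def, Fin.le_def] at *
  omega

theorem pos_inl_lt_inr_iff (h : IsConjugate l u) (i j : Fin k) :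
    h.pos (Sum.inl i) < h.pos (Sum.inr j) ↔ (j : ℕ) < l i := by
  have h1 := h.row_le i
  have h3 := h.lt_iff i j
  simp only [pos, Sum.elim_inl, Sum.elim_inr, Fin.lt_def] at *
  omega

theorem pos_inr_lt_inl_iff (h : IsConjugate l u) (i j : Fin k) :
    h.pos (Sum.inr j) < h.pos (Sum.inl i) ↔ ¬ (j : ℕ) < l i := by
  have h1 := h.row_le i
  have h3 := h.lt_iff i j
  simp only [pos, Sum.elim_inl, Sum.elim_inr, Fin.lt_def] at *
  omega

theorem pos_injective (h : IsConjugate l u) : Function.Injective h.pos := by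
  rintro (i | j) (i' | j') e
  · have h1 := h.pos_inl_lt_iff i i'
    have h2 := h.pos_inl_lt_iff i' i
    simp only [e, lt_irrefl, false_iff, not_lt] at h1 h2
    rw [le_antisymm h2 h1]
  · have h1 := h.pos_inl_lt_inr_iff i j'
    have h2 := h.pos_inr_lt_inl_iff i j'
    simp only [e, lt_irrefl, false_iff] at h1 h2
    exact absurd h1 h2
  · have h1 := h.pos_inl_lt_inr_iff i' j
    have h2 := h.pos_inr_lt_inl_iff i' j
    simp only [e, lt_irrefl, false_iff] at h1 h2
    exact absurd h1 h2
  · have h1 := h.pos_inr_lt_iff j j'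
    have h2 := h.pos_inr_lt_iff j' j
    simp only [e, lt_irrefl, false_iff, not_lt] at h1 h2
    rw [le_antisymm h1 h2]

/-- `pos` as an equivalence. -/
noncomputable def posEquiv (h : IsConjugate l u) : Fin k ⊕ Fin k ≃ Fin (2 * k) :=
  Equiv.ofBijective h.pos ((Fintype.bijective_iff_injective_and_card _).2
    ⟨h.pos_injective, by simp [two_mul]⟩)

theorem posEquiv_apply (h : IsConjugate l u) (s) : h.posEquiv s = h.pos s := rfl

end IsConjugate

theorem isConjugate_zero (k : ℕ) : IsConjugate (fun _ : Fin k => 0) (fun _ : Fin k => 0) :=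
  ⟨fun _ => Nat.zero_le _, fun _ => Nat.zero_le _, by simp⟩

theorem isConjugate_staircase (k : ℕ) :
    IsConjugate (fun i : Fin k => k - i) (fun i : Fin k => k - i) :=
  ⟨fun _ => Nat.sub_le _ _, fun _ => Nat.sub_le _ _, fun i j => by omega⟩

/-- For the empty partition every `inr` position precedes every `inl` position, and the order within
each kind is the same for all partitions. The inversions are therefore the pairs (i, j) with j < l
i, that is, the cells of the diagram. -/
theorem IsConjugate.sign_posEquiv {k : ℕ} {l u : Fin k → ℕ} (h : IsConjugate l u) :
    Equiv.Perm.sign (h.posEquiv.trans (isConjugate_zero k).posEquiv.symm) =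
      (-1) ^ ∑ i, l i := by
  set e₀ := (isConjugate_zero k).posEquiv with he₀
  -- Conjugation by `e₀` moves the permutation to the ordered set `Fin (2 * k)`, where inversions
  -- can be counted.
  have h1 : Equiv.Perm.sign (h.posEquiv.trans e₀.symm) =
      Equiv.Perm.sign (e₀.symm.trans h.posEquiv) :=
    Equiv.Perm.sign_eq_sign_of_equiv _ _ e₀ (by simp)
  have h2 : Equiv.Perm.sign (e₀.symm.trans h.posEquiv) = ∏ s, ∏ t,
      if e₀ s < e₀ t ∧ ¬ h.posEquiv s < h.posEquiv t then (-1 : ℤˣ) else 1 := by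
    rw [Equiv.Perm.sign_eq_prod_prod_Ioi, ← Equiv.prod_comp e₀]
    refine Finset.prod_congr rfl fun s _ => ?_
    rw [← Finset.filter_lt_eq_Ioi, Finset.prod_filter,
      ← Equiv.prod_comp e₀]
    refine Finset.prod_congr rfl fun t _ => ?_
    simp only [Equiv.trans_apply, Equiv.symm_apply_apply]
    split_ifs <;> first | rfl | (exfalso; grind)
  rw [h1, h2, Fintype.prod_sum_type]
  simp only [Fintype.prod_sum_type, he₀, IsConjugate.posEquiv_apply, IsConjugate.pos_inl_lt_iff,
    IsConjugate.pos_inr_lt_iff, IsConjugate.pos_inl_lt_inr_iff, IsConjugate.pos_inr_lt_inl_iff,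
    and_not_self, if_false, Finset.prod_const_one, not_lt_zero, false_and, one_mul, mul_one,
    not_false_eq_true, true_and, not_not]
  rw [Finset.prod_comm, ← Finset.prod_pow_eq_pow_sum]
  refine Finset.prod_congr rfl fun i _ => ?_
  rw [← Finset.prod_filter, Finset.prod_const, h.card_filter]

end BinomDet

/-! ### The z-formula by complementary minors of the Pascal matrix -/

namespace BinomDet

open Polynomial

/-- The polynomial `(1 + 2 z) (z (1 + z)) ^ s`. -/
noncomputable def oddPoly (s : ℕ) : ℚ[X] := (1 + 2 * X) * (X * (1 + X)) ^ s

theorem natDegree_X_mul_one_add_X : (X * (1 + X) : ℚ[X]).natDegree ≤ 2 := by compute_degree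

theorem natDegree_one_add_two_mul_X : (1 + 2 * X : ℚ[X]).natDegree ≤ 1 := by compute_degree

theorem natDegree_oddPoly (s : ℕ) : (oddPoly s).natDegree ≤ 2 * s + 1 := by
  refine natDegree_mul_le.trans ?_
  have h1 := natDegree_pow_le_of_le s natDegree_X_mul_one_add_X
  have h2 := natDegree_one_add_two_mul_X
  omega

theorem coeff_oddPoly_top (s : ℕ) : (oddPoly s).coeff (2 * s + 1) = 2 := by
  have h1 := natDegree_pow_le_of_le s natDegree_X_mul_one_add_X
  rw [oddPoly, add_comm (2 * s), mul_comm 2 s,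
    coeff_mul_add_eq_of_natDegree_le natDegree_one_add_two_mul_X h1,
    coeff_pow_of_natDegree_le natDegree_X_mul_one_add_X]
  have h2 : (1 + 2 * X : ℚ[X]).coeff 1 = 2 := by
    rw [coeff_add, show (2 : ℚ[X]) = C 2 from rfl, coeff_C_mul]; simp [coeff_one]
  have h3 : (X * (1 + X) : ℚ[X]).coeff 2 = 1 := by
    rw [coeff_X_mul, coeff_add]; simp [coeff_one]
  rw [h2, h3]
  simp

/-- Putting z = -(1+x)/2 turns 1+2z into -x and z(1+z) into (x^2-1)/4, so the result is odd in x. -/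
theorem coeff_even_oddPoly_comp (s c : ℕ) :
    (((oddPoly s).comp (C (-1 / 2) * X)).comp (X + 1)).coeff (2 * c) = 0 := by
  set f : ℚ[X] := ((oddPoly s).comp (C (-1 / 2) * X)).comp (X + 1) with hf
  have hC : (2 : ℚ[X]) * C (-1 / 2) = -1 := by
    rw [← C_ofNat, ← C_mul]; norm_num
  have h1 : f = -X * (C (-1 / 2) * (1 + X) * (1 + C (-1 / 2) * (1 + X))) ^ s := by
    rw [hf, oddPoly]
    simp only [mul_comp, pow_comp, add_comp, one_comp, X_comp, C_comp, Polynomial.ofNat_comp,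
      Nat.cast_ofNat]
    rw [← mul_assoc 2, hC]
    ring
  have h2 : f.comp (-X) = -f := by
    rw [h1]
    simp only [mul_comp, pow_comp, add_comp, one_comp, X_comp, C_comp, neg_comp]
    have h3 : C (-1 / 2) * (1 + -X) * (1 + C (-1 / 2) * (1 + -X)) =
        C (-1 / 2) * (1 + X) * (1 + C (-1 / 2) * (1 + X) : ℚ[X]) := by
      linear_combination (-2 * X * C (-1 / 2)) * hC
    rw [h3]
    ring
  have h4 := congrArg (fun p : ℚ[X] => p.coeff (2 * c)) h2
  have h5 : (-X : ℚ[X]) = C (-1) * X := by simp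
  simp only [h5, comp_C_mul_X_coeff, coeff_neg] at h4
  rw [pow_mul] at h4
  norm_num at h4
  linarith

theorem coeff_comp_X_add_one (p : ℚ[X]) (n d : ℕ) (hp : p.natDegree < n) :
    (p.comp (X + 1)).coeff d = ∑ a : Fin n, p.coeff a * ((a : ℕ).choose d : ℚ) := by
  rw [comp, eval₂_eq_sum_range' _ hp, finsetSum_coeff,
    Fin.sum_univ_eq_sum_range (fun a => p.coeff a * (a.choose d : ℚ))]
  simp only [coeff_C_mul, coeff_X_add_one_pow]

/-- The coefficients of the polynomials `(1 + 2 z) (z (1 + z)) ^ (k - 1 - j)`. -/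
noncomputable def zMatrix (k : ℕ) (u : Fin k → ℕ) : Matrix (Fin k) (Fin k) ℚ :=
  Matrix.of fun i j => (oddPoly (k - ((j : ℕ) + 1))).coeff (u i + (k - ((i : ℕ) + 1)))

/-- Enumerates the even numbers, then the odd numbers below `2 k`. -/
def parityIndex (k : ℕ) : Fin k ⊕ Fin k → Fin (2 * k) :=
  Sum.elim (fun c => ⟨2 * c, by omega⟩) (fun c => ⟨2 * c + 1, by omega⟩)

theorem parityIndex_bijective (k : ℕ) : Function.Bijective (parityIndex k) := by
  refine (Fintype.bijective_iff_injective_and_card _).2 ⟨?_, by simp [two_mul]⟩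
  rintro (i | i) (j | j) h <;> simp only [parityIndex, Sum.elim_inl, Sum.elim_inr,
    Fin.mk.injEq] at h
  · congr 1; omega
  · omega
  · omega
  · congr 1; omega

/-- The Pascal matrix with rows permuted by `e` and columns sorted by parity. -/
def pascal {k : ℕ} (e : Fin k ⊕ Fin k → Fin (2 * k)) :
    Matrix (Fin k ⊕ Fin k) (Fin k ⊕ Fin k) ℚ :=
  Matrix.of fun s t => ((e s : ℕ).choose (parityIndex k t : ℕ) : ℚ)

theorem det_pascal_ne_zero {k : ℕ} (e : Fin k ⊕ Fin k ≃ Fin (2 * k)) : (pascal e).det ≠ 0 := by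
  let A : Matrix (Fin (2 * k)) (Fin (2 * k)) ℚ :=
    Matrix.of fun a d => ((a : ℕ).choose (d : ℕ) : ℚ)
  have hA : A.det = 1 := by
    rw [Matrix.det_of_isLowerTriangular]
    · simp [A]
    · intro i j hij
      have : i < j := hij
      simp [A, Nat.choose_eq_zero_of_lt (Fin.lt_def.1 this)]
  have h1 : pascal e = A.submatrix e (Equiv.ofBijective _ (parityIndex_bijective k)) := rfl
  rw [h1, ← isUnit_iff_ne_zero, ← Matrix.isUnit_iff_isUnit_det, Matrix.isUnit_submatrix_equiv,
    Matrix.isUnit_iff_isUnit_det, hA]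
  exact isUnit_one

theorem IsConjugate.det_pascal {k : ℕ} {l u : Fin k → ℕ} (h : IsConjugate l u) :
    (pascal h.posEquiv).det = (-1) ^ (∑ i, l i) * (pascal (isConjugate_zero k).posEquiv).det := by
  have h1 : pascal h.posEquiv = (pascal (isConjugate_zero k).posEquiv).submatrix
      (h.posEquiv.trans (isConjugate_zero k).posEquiv.symm) id := by
    ext s t
    simp [pascal]
  rw [h1, Matrix.det_permute, h.sign_posEquiv]
  simp

/-- The odd coefficients of the polynomials `oddPoly`, expanded around `-1 / 2`. -/
noncomputable def oddMatrix (k : ℕ) : Matrix (Fin k) (Fin k) ℚ := Matrix.of fun j c =>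
  (((oddPoly (k - ((j : ℕ) + 1))).comp (C (-1 / 2) * X)).comp (X + 1)).coeff (2 * (c : ℕ) + 1)

/-- Jacobi's complementary minor argument: the Pascal rows at the `inl` positions are kept, and
those at the `inr` positions are replaced by the combinations giving the shifted polynomials. Their
even columns vanish, so the product is block triangular. -/
theorem IsConjugate.det_zMatrix_mul_det_pascal {k : ℕ} {l u : Fin k → ℕ}
    (h : IsConjugate l u) :
    (∏ j : Fin k, (-1 / 2 : ℚ) ^ (u j + (k - ((j : ℕ) + 1)))) * (zMatrix k u).det *
      (pascal h.posEquiv).det = (binomMatrix k l).det * (oddMatrix k).det := by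
  let O : Fin k → ℚ[X] := fun j => (oddPoly (k - ((j : ℕ) + 1))).comp (C (-1 / 2) * X)
  have hO : ∀ j, (O j).natDegree < 2 * k := by
    intro j
    refine lt_of_le_of_lt natDegree_comp_le ?_
    have h1 := natDegree_oddPoly (k - ((j : ℕ) + 1))
    have h2 : (C (-1 / 2 : ℚ) * X).natDegree ≤ 1 := (natDegree_C_mul_le _ _).trans natDegree_X_le
    have h3 := Nat.mul_le_mul h1 h2
    omega
  let Y : Matrix (Fin k) (Fin k) ℚ := Matrix.of fun j i => (O j).coeff (h.pos (Sum.inl i))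
  let Z : Matrix (Fin k) (Fin k) ℚ := Matrix.of fun j i => (O j).coeff (h.pos (Sum.inr i))
  have hmul : Matrix.fromBlocks (1 : Matrix (Fin k) (Fin k) ℚ) 0 Y Z * pascal h.posEquiv = Matrix.fromBlocks
      (binomMatrix k l) (Matrix.of fun i (c : Fin k) => ((h.pos (Sum.inl i) : ℕ).choose (2 * (c : ℕ) + 1) : ℚ))
      0 (oddMatrix k) := by
    have hrow : ∀ (j : Fin k) t, (Matrix.fromBlocks (1 : Matrix (Fin k) (Fin k) ℚ) 0 Y Z * pascal h.posEquiv) (Sum.inr j) t =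
        ((O j).comp (X + 1)).coeff (parityIndex k t) := by
      intro j t
      rw [coeff_comp_X_add_one _ _ _ (hO j), ← Equiv.sum_comp h.posEquiv, Matrix.mul_apply]
      refine Finset.sum_congr rfl fun s _ => ?_
      rcases s with s | s <;> rfl
    have hrow' : ∀ (i : Fin k) t, (Matrix.fromBlocks (1 : Matrix (Fin k) (Fin k) ℚ) 0 Y Z * pascal h.posEquiv) (Sum.inl i) t =
        ((h.pos (Sum.inl i) : ℕ).choose (parityIndex k t : ℕ) : ℚ) := by
      intro i t
      rw [Matrix.mul_apply, Fintype.sum_sum_type]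
      simp [Matrix.one_apply, pascal, IsConjugate.posEquiv_apply]
    ext s t
    rcases s with i | j
    · rw [hrow']
      rcases t with c | c <;> rfl
    · rw [hrow]
      rcases t with c | c
      · exact coeff_even_oddPoly_comp _ _
      · rfl
  have hZ : Z.det = (∏ j : Fin k, (-1 / 2 : ℚ) ^ (u j + (k - ((j : ℕ) + 1)))) *
      (zMatrix k u).det := by
    rw [← Matrix.det_transpose, ← Matrix.det_mul_column]
    congr 1
    ext i j
    simp only [Z, O, zMatrix, Matrix.transpose_apply, Matrix.of_apply, IsConjugate.pos,
      Sum.elim_inr, comp_C_mul_X_coeff]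
    rw [mul_comm, add_comm]
  have hdet := congrArg Matrix.det hmul
  rw [Matrix.det_mul, Matrix.det_fromBlocks_zero₁₂, Matrix.det_fromBlocks_zero₂₁, Matrix.det_one,
    one_mul, hZ] at hdet
  exact hdet

theorem IsConjugate.det_zMatrix_mul_const {k : ℕ} {l u : Fin k → ℕ} (h : IsConjugate l u) :
    ((∏ j : Fin k, (-1 / 2 : ℚ) ^ (k - ((j : ℕ) + 1))) *
      (pascal (isConjugate_zero k).posEquiv).det) * (zMatrix k u).det =
      2 ^ (∑ i, l i) * (binomMatrix k l).det * (oddMatrix k).det := by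
  have h1 := h.det_zMatrix_mul_det_pascal
  simp only [pow_add, Finset.prod_mul_distrib] at h1
  rw [h.det_pascal, Finset.prod_pow_eq_pow_sum, ← h.sum_eq] at h1
  rw [mul_assoc _ (binomMatrix k l).det, ← h1]
  -- The sign of the shuffle cancels the sign coming from the powers of -1/2.
  have h2 : (2 : ℚ) ^ (∑ i, l i) * ((-1 / 2) ^ (∑ i, l i) * (-1) ^ (∑ i, l i)) = 1 := by
    rw [← mul_pow, ← mul_pow]; norm_num
  linear_combination (-(∏ j : Fin k, (-1 / 2 : ℚ) ^ (k - ((j : ℕ) + 1))) *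
      (pascal (isConjugate_zero k).posEquiv).det * (zMatrix k u).det) * h2

/-- At the staircase the positions k + i - l i are exactly the even numbers 2i, so the matrix is
unitriangular. -/
theorem det_binomMatrix_staircase (k : ℕ) :
    (binomMatrix k fun i => k - i).det = 1 := by
  have h : ∀ i : Fin k, k + (i : ℕ) - (k - i) = 2 * i := fun i => by omega
  rw [Matrix.det_of_isLowerTriangular]
  · simp [binomMatrix, h]
  · intro i j hij
    have hij : i < j := hij
    simp only [binomMatrix, Matrix.of_apply, h]
    rw [Nat.choose_eq_zero_of_lt (by omega), Nat.cast_zero]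

theorem det_zMatrix_staircase (k : ℕ) :
    (zMatrix k fun i => k - i).det = 2 ^ k := by
  have h : ∀ i : Fin k, k - (i : ℕ) + (k - (i + 1)) = 2 * (k - (i + 1)) + 1 := fun i => by omega
  rw [Matrix.det_of_isLowerTriangular]
  · simp [zMatrix, h, coeff_oddPoly_top]
  · intro i j hij
    have hij : i < j := hij
    simp only [zMatrix, Matrix.of_apply, h]
    refine coeff_eq_zero_of_natDegree_lt (lt_of_le_of_lt (natDegree_oddPoly _) ?_)
    omega

theorem sum_staircase (k : ℕ) : ∑ i : Fin k, (k - (i : ℕ)) = k.choose 2 + k := by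
  rw [Fin.sum_univ_eq_sum_range (fun i => k - i), ← Finset.sum_range_reflect]
  have : ∀ j ∈ Finset.range k, k - (k - 1 - j) = j + 1 := fun j hj => by
    rw [Finset.mem_range] at hj; omega
  rw [Finset.sum_congr rfl this, Finset.sum_add_distrib, Finset.sum_range_id, Nat.choose_two_right]
  simp

theorem IsConjugate.two_pow_mul_det_binomMatrix {k : ℕ} {l u : Fin k → ℕ}
    (h : IsConjugate l u) :
    2 ^ (∑ i, l i) * (binomMatrix k l).det = 2 ^ (k.choose 2) * (zMatrix k u).det := by
  -- The staircase evaluates the unknown constant as 2^binom(k,2) times the determinant of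
  -- `oddMatrix`.
  have h1 := (isConjugate_staircase k).det_zMatrix_mul_const
  rw [det_binomMatrix_staircase, det_zMatrix_staircase, sum_staircase, pow_add, mul_one,
    mul_right_comm _ (2 ^ k)] at h1
  have h2 := mul_right_cancel₀ (pow_ne_zero k two_ne_zero) h1
  have h3 := h.det_zMatrix_mul_const
  rw [h2] at h3
  -- By `h2` this determinant divides a product of nonzero factors: powers of -1/2 and an invertible
  -- Pascal determinant.
  have h4 : (oddMatrix k).det ≠ 0 := by
    intro h0
    rw [h0, mul_zero, mul_eq_zero, Finset.prod_eq_zero_iff] at h2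
    rcases h2 with ⟨j, _, hj⟩ | h2
    · exact pow_ne_zero _ (by norm_num) hj
    · exact det_pascal_ne_zero _ h2
  apply mul_right_cancel₀ h4
  rw [← h3]
  ring

theorem det_zMatrix_eq (k n : ℕ) (u : ℕ → ℕ) (hn : ∀ i, n ≤ i → u i = 0) (hk : n ≤ k) :
    (zMatrix k fun i => u i).det = Matrix.det (Matrix.of fun i j : Fin n =>
      PowerSeries.coeff (u i + (n - ((i : ℕ) + 1)))
        ((PowerSeries.X * (1 + PowerSeries.X) : PowerSeries ℚ) ^ (n - ((j : ℕ) + 1)) *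
          ((1 + 2 * PowerSeries.X) * (1 + PowerSeries.X) ^ (k - n)))) := by
  have hz : zMatrix k (fun i => u i) = Matrix.of fun i j : Fin k =>
      PowerSeries.coeff (u i + (k - ((i : ℕ) + 1)))
        ((PowerSeries.X * (1 + PowerSeries.X) : PowerSeries ℚ) ^ (k - ((j : ℕ) + 1)) *
          ((1 + 2 * PowerSeries.X) * (1 + PowerSeries.X) ^ (k - k))) := by
    ext i j
    rw [zMatrix, Matrix.of_apply, Matrix.of_apply, ← Polynomial.coeff_coe, oddPoly,
      ← Polynomial.coeToPowerSeries.ringHom_apply]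
    simp only [map_mul, map_add, map_pow, map_one, map_ofNat,
      Polynomial.coeToPowerSeries.ringHom_apply, Polynomial.coe_X, Nat.sub_self, pow_zero, mul_one]
    rw [mul_comm]
  have key : ∀ N : ℕ, N ≤ k → (Matrix.of fun i j : Fin N =>
      PowerSeries.coeff (u i + (N - ((i : ℕ) + 1)))
        ((PowerSeries.X * (1 + PowerSeries.X) : PowerSeries ℚ) ^ (N - ((j : ℕ) + 1)) *
          ((1 + 2 * PowerSeries.X) * (1 + PowerSeries.X) ^ (k - N)))) =
      Matrix.of fun i j : Fin N => (fun i j : ℕ => if i ≤ u i + j then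
        PowerSeries.coeff (u i + j - i) ((1 + 2 * PowerSeries.X : PowerSeries ℚ) *
          (1 + PowerSeries.X) ^ (k - (j + 1))) else 0) i j := by
    intro N hN
    ext i j
    exact coeff_zSeries_entry k (u i) i j N i.2 j.2 hN
  rw [hz, key k le_rfl, key n hk]
  refine det_eq_det_of_triangular_tail (fun i j : ℕ => if i ≤ u i + j then
        PowerSeries.coeff (u i + j - i) ((1 + 2 * PowerSeries.X : PowerSeries ℚ) *
          (1 + PowerSeries.X) ^ (k - (j + 1))) else 0) n (fun i j hi hj => ?_)
    (fun i hi => ?_) hk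
  · simp [hn i hi, hj]
  · simp [hn i hi, PowerSeries.coeff_zero_eq_constantCoeff]

/-- The constant left open on the y-side is the binomial determinant of the empty partition, which
the z-formula evaluates as 2^binom(k,2). -/
theorem two_pow_mul_det_binomMatrix_eq_yMatrix {k : ℕ} {l : Fin k → ℕ} (hl : ∀ i, l i ≤ k) :
    2 ^ (∑ i, l i) * (binomMatrix k l).det = 2 ^ (k.choose 2) * (yMatrix k l).det := by
  have h1 := (isConjugate_zero k).two_pow_mul_det_binomMatrix
  have h2 : (zMatrix k fun _ => 0).det = 1 := by
    rw [det_zMatrix_eq k 0 (fun _ => 0) (fun _ _ => rfl) (Nat.zero_le k)]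
    simp
  rw [Finset.sum_const_zero, pow_zero, one_mul, h2, mul_one] at h1
  rw [two_pow_mul_det_binomMatrix_eq_det_zero k l hl, h1]

end BinomDet

/-! ### Translation from Young diagrams -/

namespace BinomDet

theorem D_eq_det_binomMatrix (lam : YoungDiagram) (k : ℕ) (h : lam.rowLen 0 ≤ k) :
    (D lam k : ℚ) = (binomMatrix k fun i => lam.rowLen i).det := by
  rw [D, ← Matrix.det_submatrix_equiv_self Fin.revPerm,
    ← eq_intCast (Int.castRingHom ℚ), RingHom.map_det]
  congr 1
  ext i j
  have h1 : lam.rowLen i ≤ k := (lam.rowLen_anti 0 i (Nat.zero_le _)).trans h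
  have h2 : k - (((Fin.rev i : Fin k) : ℕ) + 1) = i := by rw [Fin.val_rev]; omega
  -- As every part is at most k, the integer upper entry is nonnegative, so `Ring.choose` becomes an
  -- ordinary binomial coefficient.
  have h3 : 2 * (k : ℤ) - (((Fin.rev i : Fin k) : ℕ) + 1) - (lam.rowLen i : ℤ) =
      ((k + i - lam.rowLen i : ℕ) : ℤ) := by rw [Fin.val_rev]; omega
  have h4 : 2 * k - 2 * (((Fin.rev j : Fin k) : ℕ) + 1) = 2 * j := by rw [Fin.val_rev]; omega
  simp only [binomMatrix, RingHom.mapMatrix_apply, Matrix.map_apply, Matrix.submatrix_apply,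
    Matrix.of_apply, Fin.revPerm_apply, eq_intCast]
  rw [h2, h3, h4, Ring.choose_natCast]
  simp

theorem isConjugate_rowLen_colLen (lam : YoungDiagram) (k : ℕ) (hr : lam.rowLen 0 ≤ k)
    (hc : lam.colLen 0 ≤ k) :
    IsConjugate (fun i : Fin k => lam.rowLen i) (fun j : Fin k => lam.colLen j) where
  row_le i := (lam.rowLen_anti 0 i (Nat.zero_le _)).trans hr
  col_le j := (lam.colLen_anti 0 j (Nat.zero_le _)).trans hc
  lt_iff i j := by rw [← YoungDiagram.mem_iff_lt_rowLen, ← YoungDiagram.mem_iff_lt_colLen]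

theorem rowLen_eq_zero (lam : YoungDiagram) {i : ℕ} (hi : lam.colLen 0 ≤ i) :
    lam.rowLen i = 0 := by
  by_contra h
  have h1 := YoungDiagram.mem_iff_lt_rowLen.2 (Nat.pos_of_ne_zero h)
  exact absurd (YoungDiagram.mem_iff_lt_colLen.1 h1) (not_lt.2 hi)

theorem sum_rowLen (lam : YoungDiagram) (k : ℕ) (hc : lam.colLen 0 ≤ k) :
    ∑ i : Fin k, lam.rowLen i = lam.card := by
  rw [Fin.sum_univ_eq_sum_range (fun i => lam.rowLen i), YoungDiagram.card,
    Finset.card_eq_sum_card_fiberwise (f := Prod.fst) (t := Finset.range k)]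
  · exact Finset.sum_congr rfl fun i _ => lam.rowLen_eq_card
  · rintro ⟨i, j⟩ h
    have h1 : (i, 0) ∈ lam := lam.up_left_mem le_rfl (Nat.zero_le j) (by simpa using h)
    simpa using (YoungDiagram.mem_iff_lt_colLen.1 h1).trans_le hc

theorem eq_two_zpow_mul {a b : ℕ} {x y : ℚ} (h : 2 ^ a * x = 2 ^ b * y) :
    x = (2 : ℚ) ^ ((b : ℤ) - (a : ℤ)) * y := by
  rw [zpow_sub₀ two_ne_zero, zpow_natCast, zpow_natCast, div_mul_eq_mul_div, ← h,
    mul_div_cancel_left₀ _ (pow_ne_zero _ two_ne_zero)]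

end BinomDet

open BinomDet in
theorem theorem2 (lam mu : YoungDiagram) (hmu : mu = lam.transpose)
    (m n k : ℕ) (hm : m = BinomDet.length lam) (hn : n = lam.rowLen 0)
    (hk : max m (lam.rowLen 0) ≤ k) :
    (BinomDet.D lam k : ℚ) =
        (2 : ℚ) ^ ((k.choose 2 : ℤ) - (lam.card : ℤ)) *
          MvPowerSeries.coeff (BinomDet.expo lam m) (BinomDet.ySeries m k) ∧
    (BinomDet.D lam k : ℚ) =
        (2 : ℚ) ^ ((k.choose 2 : ℤ) - (lam.card : ℤ)) *
          MvPolynomial.coeff (BinomDet.expo mu n) (BinomDet.zPoly n k) := by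
  rw [BinomDet.length, YoungDiagram.length_rowLens] at hm
  have hmk : m ≤ k := (le_max_left _ _).trans hk
  have hrk : lam.rowLen 0 ≤ k := (le_max_right _ _).trans hk
  have hconj := isConjugate_rowLen_colLen lam k hrk (hm ▸ hmk)
  rw [D_eq_det_binomMatrix lam k hrk]
  constructor
  · apply eq_two_zpow_mul
    have h1 := two_pow_mul_det_binomMatrix_eq_yMatrix hconj.row_le
    rw [sum_rowLen lam k (hm ▸ hmk),
      det_yMatrix_eq k m lam.rowLen (fun i hi => rowLen_eq_zero lam (hm ▸ hi)) hmk] at h1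
    rw [h1, coeff_ySeries]
    rfl
  · apply eq_two_zpow_mul
    have h1 := hconj.two_pow_mul_det_binomMatrix
    have h0 : ∀ i, n ≤ i → lam.colLen i = 0 := fun i hi => by
      rw [← lam.rowLen_transpose]
      exact rowLen_eq_zero _ (by rw [lam.colLen_transpose]; exact hn ▸ hi)
    rw [sum_rowLen lam k (hm ▸ hmk), det_zMatrix_eq k n lam.colLen h0 (hn ▸ hrk)] at h1
    rw [h1, coeff_zPoly]
    simp only [← lam.rowLen_transpose, ← hmu]
    rfl
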